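/- Let $n\ge 1$ and let $\mathbb{S}^{n-1}=\{y\in\mathbb{R}^n:\|y\|_2=1\}$ carry the Riemannian metric for which the inclusion into $\mathbb{R}^n$ is isometric. Let $p:\mathbb{S}^{n-1}\to(0,\infty)$ be a smooth positive function (the target density), $K:\mathbb{S}^{n-1}\times\mathbb{S}^{n-1}\to\mathbb{R}$ a smooth function (the kernel) and $q$ a probability measure on $\mathbb{S}^{n-1}$. Define $$\hat f(A')=\mathbb{E}_{q(A)}\Big[\big(\mathrm{grad}\,K(A,A')\big)[\log p(A)]+\Delta K(A,A')\Big],\qquad \hat X=\mathrm{grad}\,\hat f,$$ where $\mathrm{grad}$ and $\Delta=\mathrm{div}\,\mathrm{grad}$ under the expectation act on $A$, and where in a local coordinate system $(x^i)$ of $\mathbb{S}^{n-1}$ with metric tensor $G=(g_{ij})$ one has $\mathrm{grad}\,h=g^{ij}\,\partial_i h\,\partial_j$ and $\mathrm{div}\,X=\partial_i(\sqrt{|G|}\,X^i)/\sqrt{|G|}$. Fix orthonormal coordinates $y=(y^1,\dots,y^n)^\top$ of $\mathbb{R}^n$, let $\nabla=(\partial_{y^1},\dots,\partial_{y^n})^\top$,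 and extend $p$ and $K$ in any way to functions on $\mathbb{R}^n$ and $\mathbb{R}^n\times\mathbb{R}^n$ that are smooth at all points of $\mathbb{S}^{n-1}$ and of $\mathbb{S}^{n-1}\times\mathbb{S}^{n-1}$. Then, with $K=K(y,y')$ and with $\nabla$ acting on $y$, the expectations of both forms of $\hat f$ exist, and on $\mathbb{S}^{n-1}$ $$\hat f(y')=\mathbb{E}_{q(y)}\Big[(\nabla\log p)^\top\nabla K+\nabla^\top\nabla K-y^\top(\nabla\nabla^\top K)\,y-(y^\top\nabla\log p+n-1)\,y^\top\nabla K\Big].$$ Moreover the right-hand side is differentiable as a function of $y'\in\mathbb{R}^n$ at every point $y'$ of the sphere, and, with $\hat X(y')$ regarded as a vector of $\mathbb{R}^n$, $$\hat X(y')=(I_n-y'y'^\top)\,\nabla'\hat f(y'),\qquad y'\in\mathbb{S}^{n-1},$$ where $\nabla'$ is the gradient in $y'\in\mathbb{R}^n$ and $\hat f$ is extended off the sphere by this right-hand side, or by any other function on $\mathbb{R}^n$ that equals $\hat f$ on the sphere and is differentiable at $y'$. All this holds whatever local coordinate systems of $\mathbb{S}^{n-1}$ are used to compute $\mathrm{grad}$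 and $\Delta$ at each point; the resulting expression does not depend on them. -/

import Mathlib

open scoped Manifold ContDiff Matrix
open MeasureTheory

noncomputable section

namespace SphereRSVGD

/-- The ambient Euclidean space `ℝⁿ` with `n = m + 1`. -/
abbrev Ambient (m : ℕ) : Type := EuclideanSpace ℝ (Fin (m + 1))

/-- The unit sphere `𝕊ⁿ⁻¹ ⊂ ℝⁿ`, `n = m + 1`, a smooth manifold of dimension `m = n - 1`. -/
abbrev USphere (m : ℕ) : Type := Metric.sphere (0 : Ambient m) 1

/-- A local map of the sphere into `ℝᵐ`, not yet assumed compatible with the smooth structure. -/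
abbrev LocalMap (m : ℕ) : Type := OpenPartialHomeomorph (USphere m) (EuclideanSpace ℝ (Fin m))

/-- `φ` is a local coordinate system (a chart of the maximal smooth atlas) around the point `A`. -/
def IsCoordAt {m : ℕ} (φ : LocalMap m) (A : USphere m) : Prop :=
  φ ∈ IsManifold.maximalAtlas (𝓡 m) ∞ (USphere m) ∧ A ∈ φ.source

/-! ### Riemannian objects of the sphere in a coordinate system `φ = (x¹, …, xᵐ)` -/

section Coordinates

variable {m : ℕ} (φ : LocalMap m)

/-- `∂ᵢ h` at `A`: the derivative of `h ∘ φ⁻¹` in the `i`-th coordinate direction at `φ A`. -/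
def partialAt (i : Fin m) (h : USphere m → ℝ) (A : USphere m) : ℝ :=
  fderiv ℝ (fun x => h (φ.symm x)) (φ A) (EuclideanSpace.single i 1)

/-- `∂y/∂xⁱ` at `A`, where `y = ξ(x)`, `ξ` is the inclusion of the sphere composed with `φ⁻¹`:
the push-forward to `ℝⁿ` of the natural basis vector `∂ᵢ`. -/
def basisVec (i : Fin m) (A : USphere m) : Ambient m :=
  fderiv ℝ (fun x => (φ.symm x : Ambient m)) (φ A) (EuclideanSpace.single i 1)

/-- The metric tensor `G = (gᵢⱼ)` for which the inclusion into `ℝⁿ` is isometric. -/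
def metricTensor (A : USphere m) : Matrix (Fin m) (Fin m) ℝ :=
  Matrix.of fun i j => inner ℝ (basisVec φ i A) (basisVec φ j A)

/-- `√|G|`. -/
def sqrtDet (A : USphere m) : ℝ := Real.sqrt (metricTensor φ A).det

/-- The components `gⁱʲ ∂ⱼ h` of the Riemannian gradient `grad h`. -/
def gradComp (h : USphere m → ℝ) (A : USphere m) (i : Fin m) : ℝ :=
  ∑ j, (metricTensor φ A)⁻¹ i j * partialAt φ j h A

/-- The action `X[h] = Xⁱ ∂ᵢ h` of a vector field with components `Xⁱ` on a function. -/
def act (X : USphere m → Fin m → ℝ) (h : USphere m → ℝ) (A : USphere m) : ℝ :=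
  ∑ i, X A i * partialAt φ i h A

/-- The divergence `∂ᵢ(√|G| Xⁱ) / √|G|` of a vector field with components `Xⁱ`. -/
def divergence (X : USphere m → Fin m → ℝ) (A : USphere m) : ℝ :=
  (∑ i, partialAt φ i (fun B => sqrtDet φ B * X B i) A) / sqrtDet φ A

/-- The Laplace-Beltrami operator `Δ h = div (grad h)`. -/
def laplaceBeltrami (h : USphere m → ℝ) (A : USphere m) : ℝ :=
  divergence φ (gradComp φ h) A

/-- The vector `Xⁱ ∂ᵢ` at `A`, as a vector of the ambient space `ℝⁿ`. -/
def embedVec (X : USphere m → Fin m → ℝ) (A : USphere m) : Ambient m :=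
  ∑ i, X A i • basisVec φ i A

/-- `(grad K(A, A'))[log p(A)] + Δ K(A, A')`, where `grad` and `Δ` act on the argument `A`. -/
def steinTerm (p : USphere m → ℝ) (K : USphere m → USphere m → ℝ) (A' A : USphere m) : ℝ :=
  act φ (gradComp φ fun B => K B A') (fun B => Real.log (p B)) A +
    laplaceBeltrami φ (fun B => K B A') A

/-- The tangent vector `grad f` at `A`, as a vector of the ambient space `ℝⁿ`. -/
def gradVec (f : USphere m → ℝ) (A : USphere m) : Ambient m :=
  embedVec φ (gradComp φ f) A

end Coordinates

/-- `f̂(A') = 𝔼_{q(A)} [(grad K(A, A'))[log p(A)] + Δ K(A, A')]`, where the objects at the point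
`A` are computed in the coordinate system `c A`. -/
def fHat {m : ℕ} (c : USphere m → LocalMap m) (p : USphere m → ℝ)
    (K : USphere m → USphere m → ℝ) (q : Measure (USphere m)) (A' : USphere m) : ℝ :=
  ∫ A, steinTerm (c A) p K A' A ∂q

/-! ### Expressions in `ℝⁿ` with respect to an orthonormal basis -/

section Embedded

variable {m : ℕ} (b : OrthonormalBasis (Fin (m + 1)) ℝ (Ambient m))

/-- The column vector `(y¹, …, yⁿ)` of the coordinates of `y`. -/
def coords (y : Ambient m) : Fin (m + 1) → ℝ := fun α => b.repr y α

/-- `∇ h = (∂h/∂y¹, …, ∂h/∂yⁿ)`. -/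
def nabla (h : Ambient m → ℝ) (y : Ambient m) : Fin (m + 1) → ℝ := fun α => fderiv ℝ h y (b α)

/-- `∇∇ᵀ h`, the matrix of second partial derivatives. -/
def hessian (h : Ambient m → ℝ) (y : Ambient m) : Matrix (Fin (m + 1)) (Fin (m + 1)) ℝ :=
  Matrix.of fun α β => nabla b (fun z => nabla b h z β) y α

/-- `(∇ log p)ᵀ ∇k + ∇ᵀ∇k - yᵀ (∇∇ᵀ k) y - (yᵀ ∇ log p + n - 1) yᵀ ∇k` at `y ∈ ℝⁿ`. -/
def embeddedTerm (p k : Ambient m → ℝ) (y : Ambient m) : ℝ :=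
  nabla b (fun z => Real.log (p z)) y ⬝ᵥ nabla b k y
    + ∑ α, nabla b (fun z => nabla b k z α) y α
    - coords b y ⬝ᵥ (hessian b k y *ᵥ coords b y)
    - (coords b y ⬝ᵥ nabla b (fun z => Real.log (p z)) y + ((m + 1 : ℕ) : ℝ) - 1)
        * (coords b y ⬝ᵥ nabla b k y)

/-- The expectation over `y ∼ q` of the embedded expression, as a function of `y' ∈ ℝⁿ`. -/
def embeddedFHat (p : Ambient m → ℝ) (K : Ambient m → Ambient m → ℝ)
    (q : Measure (USphere m)) (y' : Ambient m) : ℝ :=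
  ∫ A : USphere m, embeddedTerm b p (fun y => K y y') (A : Ambient m) ∂q

/-- `(Iₙ - y yᵀ) ∇F` at `y`. -/
def projNabla (F : Ambient m → ℝ) (y : Ambient m) : Fin (m + 1) → ℝ :=
  (1 - Matrix.vecMulVec (coords b y) (coords b y)) *ᵥ nabla b F y

end Embedded

end SphereRSVGD

end

/-! Let `J` be the Jacobian of an inverse chart in orthonormal ambient coordinates, and `y` the
point of the sphere. The metric tensor is `JᵀJ`, and the columns of `J` are `n - 1` independent
vectors orthogonal to the unit vector `y`; hence `J (JᵀJ)⁻¹ Jᵀ = P`, where `P = 1 - y yᵀ`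
(`jacobian_projection`). A Riemannian gradient, seen in the ambient space, is therefore `P ∇k` for
any differentiable extension `k`, with no trace of the chart left (`coords_gradVec`).

For the divergence of a field with components `W`, Jacobi's formula and the symmetry of the second
derivatives of the inverse chart give the contraction of `J (JᵀJ)⁻¹` with the derivatives of `V = J
W` (`sum_fderiv_sqrt_det_mul_div`); by the chain rule this is the trace of `P` times the ambient
derivative of `V`. Taking `V = P ∇k = ∇k - (yᵀ∇k) y` yields `laplaceBeltrami_eq`, and the two
integrands agree pointwise (`steinTerm_eq_embeddedTerm`).

The rest is analysis: the embedded integrand is jointly smooth at pairs of points of the compact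
sphere, so it is integrable and its integral is differentiable in `y'`
(`differentiableAt_integral_of_contDiffAt`). The gradient formula then applies to the integral
itself. -/

namespace SphereRSVGD

/-! ### Gram matrices and the projection onto a hyperplane -/

section LinearAlgebra

variable {ι κ : Type*} [Fintype ι] [Fintype κ] [DecidableEq κ]

/-- If the columns of `M` span a hyperplane with unit normal `y`, the orthogonal projection
`M (Mᵀ M)⁻¹ Mᵀ` onto the column space is `1 - y yᵀ`. -/
theorem mul_gram_inv_mul_transpose_eq [DecidableEq ι] (M : Matrix ι κ ℝ) (y : ι → ℝ)
    (hcard : Fintype.card ι = Fintype.card κ + 1) (hy : y ⬝ᵥ y = 1) (hyM : y ᵥ* M = 0)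
    (hdet : IsUnit (Mᵀ * M).det) :
    M * (Mᵀ * M)⁻¹ * Mᵀ = 1 - Matrix.vecMulVec y y := by
  set Q := M * (Mᵀ * M)⁻¹ * Mᵀ with hQ
  set Y := Matrix.vecMulVec y y with hY
  have hQQ : Q * Q = Q := by
    have : Q * Q = M * ((Mᵀ * M)⁻¹ * (Mᵀ * M)) * (Mᵀ * M)⁻¹ * Mᵀ := by
      simp only [hQ, Matrix.mul_assoc]
    rw [this, Matrix.nonsing_inv_mul _ hdet, Matrix.mul_one]
  have hQT : Qᵀ = Q := by
    simp [hQ, Matrix.transpose_mul, Matrix.transpose_nonsing_inv, Matrix.mul_assoc]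
  have hYT : Yᵀ = Y := by
    ext i j
    simp [hY, Matrix.vecMulVec_apply, mul_comm]
  have hYY : Y * Y = Y := by
    rw [hY, Matrix.vecMulVec_mul_vecMulVec, hy]; simp
  have hYM : Y * M = 0 := by
    rw [hY, Matrix.vecMulVec_mul, hyM]
    ext i j
    exact mul_zero _
  have hYQ : Y * Q = 0 := by
    rw [hQ, ← Matrix.mul_assoc, ← Matrix.mul_assoc, hYM, Matrix.zero_mul, Matrix.zero_mul]
  have hQY : Q * Y = 0 := by
    have := congrArg Matrix.transpose hYQ
    simpa [Matrix.transpose_mul, hQT, hYT] using this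
  have htrQ : Q.trace = Fintype.card κ := by
    rw [hQ, Matrix.trace_mul_comm, ← Matrix.mul_assoc, Matrix.mul_nonsing_inv _ hdet,
      Matrix.trace_one]
  have htrY : Y.trace = 1 := by rw [hY, Matrix.trace_vecMulVec, hy]
  -- The remainder `R = 1 - Q - Y` is a symmetric idempotent, so `tr (Rᴴ R) = tr R`, which the
  -- dimension count makes zero; this forces `R = 0`.
  have hR : (1 - Q - Y)ᴴ * (1 - Q - Y) = 1 - Q - Y := by
    rw [Matrix.conjTranspose_eq_transpose_of_trivial]
    simp only [Matrix.transpose_sub, hQT, hYT, Matrix.transpose_one, Matrix.sub_mul,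
      Matrix.mul_sub, hQQ, hYY, hYQ, hQY, Matrix.one_mul, Matrix.mul_one]
    abel
  have h0 : (1 - Q - Y : Matrix ι ι ℝ) = 0 := by
    rw [← Matrix.trace_conjTranspose_mul_self_eq_zero_iff, hR, Matrix.trace_sub, Matrix.trace_sub,
      Matrix.trace_one, htrQ, htrY, hcard]
    push_cast; ring
  have h1 : Q = 1 - Y - (1 - Q - Y) := by abel
  rw [h1, h0, sub_zero]

theorem det_gram_pos (M : Matrix ι κ ℝ) (hM : Function.Injective M.mulVec) :
    0 < (Mᵀ * M).det := by
  have h := Matrix.PosDef.conjTranspose_mul_self M hM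
  rw [Matrix.conjTranspose_eq_transpose_of_trivial] at h
  exact h.det_pos

theorem trace_one_sub_vecMulVec_mul [DecidableEq ι] (y : ι → ℝ) (T : Matrix ι ι ℝ) :
    ((1 - Matrix.vecMulVec y y) * T).trace = T.trace - y ⬝ᵥ (T *ᵥ y) := by
  rw [Matrix.sub_mul, Matrix.one_mul, Matrix.trace_sub, Matrix.vecMulVec_mul,
    Matrix.trace_vecMulVec, dotProduct_comm, Matrix.dotProduct_mulVec]

/-- The divergence of `W` with respect to the Gram matrix `Mᵀ M`, in terms of `V = M W`:
`w j i = ∂ⱼ Wⁱ` and `D j = ∂ⱼ M`, symmetric because `M` is a Jacobian. -/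
theorem sum_trace_gram_eq (M N : Matrix ι κ ℝ) (hMN : Nᵀ * M = 1) (D : κ → Matrix ι κ ℝ)
    (hD : ∀ i j α, D i α j = D j α i) (W : κ → ℝ) (w : κ → κ → ℝ) :
    ∑ i, (w i i + (Nᵀ * D i).trace * W i) =
      ∑ j, ∑ α, N α j * ∑ i, (D j α i * W i + M α i * w j i) := by
  have h1 : ∀ i j, ∑ α, N α j * M α i = if j = i then 1 else 0 := fun i j => by
    have := congrFun (congrFun hMN j) i
    rwa [Matrix.mul_apply, Matrix.one_apply] at this
  -- Duality of `N` and `M` isolates `w j j`; the symmetry of `D` moves the index `i` onto the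
  -- derivative, so that summing over `j` produces the trace of `Nᵀ * D i`.
  have h2 : ∀ j, ∑ α, N α j * ∑ i, (D j α i * W i + M α i * w j i) =
      w j j + ∑ i, (∑ α, N α j * D i α j) * W i := fun j => by
    have h3 : ∑ i, (∑ α, N α j * M α i) * w j i = w j j := by simp [h1]
    rw [← h3, ← Finset.sum_add_distrib]
    simp only [Finset.mul_sum, Finset.sum_mul]
    rw [Finset.sum_comm]
    refine Finset.sum_congr rfl fun i _ => ?_
    rw [← Finset.sum_add_distrib]
    refine Finset.sum_congr rfl fun α _ => ?_
    rw [hD i j]; ring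
  simp only [h2]
  rw [Finset.sum_add_distrib, Finset.sum_add_distrib]
  congr 1
  rw [Finset.sum_comm]
  refine Finset.sum_congr rfl fun i _ => ?_
  rw [← Finset.sum_mul, Matrix.trace]
  simp [Matrix.mul_apply]

end LinearAlgebra

/-! ### Derivatives of determinants and the coordinate divergence -/

section Calculus

variable {E : Type*} [NormedAddCommGroup E] [NormedSpace ℝ E]
  {ι κ : Type*} [Fintype ι] [Fintype κ] [DecidableEq κ]

/-- Jacobi's formula. -/
theorem hasFDerivAt_det {G : E → Matrix κ κ ℝ} {G' : κ → κ → E →L[ℝ] ℝ} {x : E}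
    (hG : ∀ i j, HasFDerivAt (fun z => G z i j) (G' i j) x) :
    HasFDerivAt (fun z => (G z).det) (∑ i, ∑ j, (G x).adjugate i j • G' j i) x := by
  have h : HasFDerivAt (fun z => (G z).det) (∑ σ : Equiv.Perm κ, ((σ.sign : ℤ) : ℝ) •
      ∑ i, (∏ j ∈ Finset.univ.erase i, G x (σ j) j) • G' (σ i) i) x := by
    simp only [Matrix.det_apply']
    refine HasFDerivAt.fun_sum fun σ _ => HasFDerivAt.const_mul ?_ _
    exact HasFDerivAt.finsetProd fun i _ => hG (σ i) i
  convert h using 1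
  ext v
  simp only [_root_.sum_apply, _root_.smul_apply, smul_eq_mul,
    Finset.mul_sum]
  rw [Finset.sum_comm (s := (Finset.univ : Finset (Equiv.Perm κ)))]
  refine Finset.sum_congr rfl fun i _ => ?_
  -- By Cramer's rule the adjugate sum is the determinant with column `i` differentiated; its
  -- Leibniz expansion is what the product rule gave.
  have h1 : ∑ j, (G x).adjugate i j * G' j i v = ((G x).updateCol i fun j => G' j i v).det := by
    rw [← Matrix.cramer_apply, Matrix.cramer_eq_adjugate_mulVec]
    rfl
  rw [h1, Matrix.det_apply']
  refine Finset.sum_congr rfl fun σ _ => ?_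
  congr 1
  rw [← Finset.prod_erase_mul _ _ (Finset.mem_univ i)]
  simp only [Matrix.updateCol_self]
  congr 1
  refine Finset.prod_congr rfl fun j hj => ?_
  rw [Matrix.updateCol_ne (Finset.ne_of_mem_erase hj)]

theorem differentiableAt_det {G : E → Matrix κ κ ℝ} {x : E}
    (hG : ∀ i j, DifferentiableAt ℝ (fun z => G z i j) x) :
    DifferentiableAt ℝ (fun z => (G z).det) x :=
  (hasFDerivAt_det fun i j => (hG i j).hasFDerivAt).differentiableAt

/-- The inverse is the adjugate over the determinant, and an adjugate entry is a determinant with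
one row made constant. -/
theorem differentiableAt_inv_apply {G : E → Matrix κ κ ℝ} {x : E}
    (hG : ∀ i j, DifferentiableAt ℝ (fun z => G z i j) x) (hdet : (G x).det ≠ 0) (i j : κ) :
    DifferentiableAt ℝ (fun z => (G z)⁻¹ i j) x := by
  simp only [Matrix.inv_def, Ring.inverse_eq_inv', Matrix.smul_apply, smul_eq_mul,
    Matrix.adjugate_apply]
  refine ((differentiableAt_det hG).inv hdet).mul (differentiableAt_det fun k l => ?_)
  simp only [Matrix.updateRow_apply]
  split_ifs
  · exact differentiableAt_const _
  · exact hG k l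

/-- The coordinate divergence of the vector field with components `W` in the metric `Mᵀ M`, where
`M` is the Jacobian of an immersion. -/
theorem sum_fderiv_sqrt_det_mul_div (e : κ → E) {M : E → Matrix ι κ ℝ} {W : E → κ → ℝ} {x : E}
    (hM : ∀ α i, DifferentiableAt ℝ (fun z => M z α i) x)
    (hsymm : ∀ i j α, fderiv ℝ (fun z => M z α j) x (e i) = fderiv ℝ (fun z => M z α i) x (e j))
    (hW : ∀ i, DifferentiableAt ℝ (fun z => W z i) x) (hdet : 0 < ((M x)ᵀ * M x).det) :
    (∑ i, fderiv ℝ (fun z => Real.sqrt ((M z)ᵀ * M z).det * W z i) x (e i)) /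
        Real.sqrt ((M x)ᵀ * M x).det =
      ∑ j, ∑ α, (M x * ((M x)ᵀ * M x)⁻¹) α j *
        fderiv ℝ (fun z => (M z *ᵥ W z) α) x (e j) := by
  classical
  set G : E → Matrix κ κ ℝ := fun z => (M z)ᵀ * M z with hGdef
  set D : κ → Matrix ι κ ℝ := fun j => Matrix.of fun α i => fderiv ℝ (fun z => M z α i) x (e j)
    with hDdef
  have hG' : ∀ i j, HasFDerivAt (fun z => G z i j)
      (∑ α, (M x α i • fderiv ℝ (fun z => M z α j) x +
        M x α j • fderiv ℝ (fun z => M z α i) x)) x := fun i j => by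
    simp only [hGdef, Matrix.mul_apply, Matrix.transpose_apply]
    exact HasFDerivAt.fun_sum fun α _ => (hM α i).hasFDerivAt.mul (hM α j).hasFDerivAt
  have hdG := hasFDerivAt_det hG'
  have hs := hdG.sqrt hdet.ne'
  have hspos : 0 < Real.sqrt (G x).det := Real.sqrt_pos.2 hdet
  have hGT : ((G x)⁻¹)ᵀ = (G x)⁻¹ := by
    rw [Matrix.transpose_nonsing_inv, hGdef]; simp [Matrix.transpose_mul]
  have hinv : (M x * (G x)⁻¹)ᵀ * M x = 1 := by
    rw [Matrix.transpose_mul, hGT, Matrix.mul_assoc]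
    exact Matrix.nonsing_inv_mul _ hdet.ne'.isUnit
  -- Both halves of the derivative of `MᵀM` contribute the same trace, since `(G x)⁻¹` is symmetric.
  -- The resulting factor 2 cancels the one from the derivative of the square root.
  have htr : ∀ v i, e i = v → (∑ k, ∑ j, (G x).adjugate k j *
      ∑ α, (M x α j * fderiv ℝ (fun z => M z α k) x v +
        M x α k * fderiv ℝ (fun z => M z α j) x v)) =
      2 * (G x).det * ((M x * (G x)⁻¹)ᵀ * D i).trace := by
    rintro _ i rfl
    have hadj : (G x).adjugate = (G x).det • (G x)⁻¹ := by
      rw [Matrix.inv_def, smul_smul, Ring.inverse_eq_inv', mul_inv_cancel₀ hdet.ne', one_smul]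
    have hsym : ∀ k j, (G x)⁻¹ k j = (G x)⁻¹ j k := fun k j => congrFun (congrFun hGT j) k
    have h1 : ((M x * (G x)⁻¹)ᵀ * D i).trace =
        ∑ k, ∑ j, (G x)⁻¹ k j * ∑ α, M x α j * D i α k := by
      rw [Matrix.transpose_mul, hGT, Matrix.mul_assoc, Matrix.trace]
      simp [Matrix.mul_apply]
    have h2 : ((M x * (G x)⁻¹)ᵀ * D i).trace =
        ∑ k, ∑ j, (G x)⁻¹ k j * ∑ α, M x α k * D i α j := by
      rw [h1, Finset.sum_comm]
      exact Finset.sum_congr rfl fun k _ => Finset.sum_congr rfl fun j _ => by rw [hsym]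
    rw [two_mul, add_mul]
    nth_rw 1 [h1]
    rw [h2, hadj, Finset.mul_sum, Finset.mul_sum, ← Finset.sum_add_distrib]
    refine Finset.sum_congr rfl fun k _ => ?_
    rw [Finset.mul_sum, Finset.mul_sum, ← Finset.sum_add_distrib]
    refine Finset.sum_congr rfl fun j _ => ?_
    rw [Finset.sum_add_distrib, Matrix.smul_apply, smul_eq_mul]
    simp only [hDdef, Matrix.of_apply]
    ring
  have hL : ∀ i, fderiv ℝ (fun z => Real.sqrt (G z).det * W z i) x (e i) =
      Real.sqrt (G x).det * (fderiv ℝ (fun z => W z i) x (e i) +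
        ((M x * (G x)⁻¹)ᵀ * D i).trace * W x i) := fun i => by
    have hmul : HasFDerivAt (fun z => Real.sqrt (G z).det * W z i) _ x :=
      hs.mul (hW i).hasFDerivAt
    rw [hmul.fderiv]
    simp only [_root_.add_apply, _root_.smul_apply,
      _root_.sum_apply, smul_eq_mul]
    rw [htr _ i rfl]
    have hsq : Real.sqrt (G x).det * Real.sqrt (G x).det = (G x).det :=
      Real.mul_self_sqrt hdet.le
    have h3 : 1 / (2 * Real.sqrt (G x).det) *
        (2 * (G x).det * ((M x * (G x)⁻¹)ᵀ * D i).trace) =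
        Real.sqrt (G x).det * ((M x * (G x)⁻¹)ᵀ * D i).trace := by
      nth_rw 2 [← hsq]
      field_simp
    rw [h3]; ring
  have hV : ∀ j α, fderiv ℝ (fun z => (M z *ᵥ W z) α) x (e j) =
      ∑ i, (D j α i * W x i + M x α i * fderiv ℝ (fun z => W z i) x (e j)) := fun j α => by
    have : HasFDerivAt (fun z => (M z *ᵥ W z) α) (∑ i, (M x α i • fderiv ℝ (fun z => W z i) x +
        W x i • fderiv ℝ (fun z => M z α i) x)) x := by
      simp only [Matrix.mulVec, dotProduct]
      exact HasFDerivAt.fun_sum fun i _ => (hM α i).hasFDerivAt.mul (hW i).hasFDerivAt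
    rw [this.fderiv]
    simp only [_root_.add_apply, _root_.smul_apply,
      _root_.sum_apply, smul_eq_mul, hDdef, Matrix.of_apply]
    exact Finset.sum_congr rfl fun i _ => by ring
  simp only [hV]
  rw [Finset.sum_congr rfl fun i _ => hL i, ← Finset.mul_sum, mul_div_cancel_left₀ _ hspos.ne']
  exact sum_trace_gram_eq (M x) _ hinv D (fun i j α => hsymm i j α) (W x)
    (fun j i => fderiv ℝ (fun z => W z i) x (e j))

end Calculus

/-! ### Charts of the sphere and their Jacobians -/

section Charts

variable {m : ℕ}

theorem contDiffAt_coe_symm {φ : LocalMap m}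
    (hφ : φ ∈ IsManifold.maximalAtlas (𝓡 m) ∞ (USphere m)) {x : EuclideanSpace ℝ (Fin m)}
    (hx : x ∈ φ.target) : ContDiffAt ℝ ∞ (fun z => (φ.symm z : Ambient m)) x := by
  have : Fact (Module.finrank ℝ (Ambient m) = m + 1) := ⟨by simp⟩
  have h1 : ContMDiffOn (𝓡 m) 𝓘(ℝ, Ambient m) ∞ (fun z => (φ.symm z : Ambient m)) φ.target :=
    contMDiff_coe_sphere.comp_contMDiffOn (contMDiffOn_symm_of_mem_maximalAtlas hφ)
  exact h1.contDiffOn.contDiffAt (φ.open_target.mem_nhds hx)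

/-- The inverse chart is a local diffeomorphism and the inclusion of the sphere is an immersion, so
the chain rule composes two injective derivatives. -/
theorem fderiv_coe_symm_injective {φ : LocalMap m}
    (hφ : φ ∈ IsManifold.maximalAtlas (𝓡 m) ∞ (USphere m)) {x : EuclideanSpace ℝ (Fin m)}
    (hx : x ∈ φ.target) :
    Function.Injective (fderiv ℝ (fun z => (φ.symm z : Ambient m)) x) := by
  have : Fact (Module.finrank ℝ (Ambient m) = m + 1) := ⟨by simp⟩
  have hφd : φ.MDifferentiable (𝓡 m) (𝓡 m) :=
    ⟨(contMDiffOn_of_mem_maximalAtlas hφ).mdifferentiableOn (by simp),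
      (contMDiffOn_symm_of_mem_maximalAtlas hφ).mdifferentiableOn (by simp)⟩
  have hsymm : Function.Injective (mfderiv (𝓡 m) (𝓡 m) φ.symm x) :=
    (hφd.symm.mfderiv_injective hx)
  have hcoe : Function.Injective (mfderiv (𝓡 m) 𝓘(ℝ, Ambient m)
      (Subtype.val : USphere m → Ambient m) (φ.symm x)) :=
    injective_mvfderiv_subtypeVal_sphere (φ.symm x)
  have hcomp : mfderiv (𝓡 m) 𝓘(ℝ, Ambient m) (fun z => (φ.symm z : Ambient m)) x =
      (mfderiv (𝓡 m) 𝓘(ℝ, Ambient m) (Subtype.val : USphere m → Ambient m) (φ.symm x)).comp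
        (mfderiv (𝓡 m) (𝓡 m) φ.symm x) :=
    mfderiv_comp x (contMDiff_coe_sphere (m := 1) |>.mdifferentiable (by simp) _)
      (hφd.mdifferentiableAt_symm hx)
  rw [← mfderiv_eq_fderiv]
  change Function.Injective (mfderiv (𝓡 m) 𝓘(ℝ, Ambient m) (fun z => (φ.symm z : Ambient m)) x)
  rw [hcomp]
  exact hcoe.comp hsymm

variable (b : OrthonormalBasis (Fin (m + 1)) ℝ (Ambient m)) (φ : LocalMap m)

/-- The Jacobian of the inverse chart, in the orthonormal coordinates of the ambient space. -/
noncomputable def jacobian (x : EuclideanSpace ℝ (Fin m)) : Matrix (Fin (m + 1)) (Fin m) ℝ :=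
  Matrix.of fun α i =>
    b.repr (fderiv ℝ (fun z => (φ.symm z : Ambient m)) x (EuclideanSpace.single i 1)) α

/-- A coordinate with respect to `b`, as a continuous linear form. -/
noncomputable def coordsCLM (α : Fin (m + 1)) : Ambient m →L[ℝ] ℝ :=
  (EuclideanSpace.proj α : Ambient m →L[ℝ] ℝ).comp
    (b.repr.toContinuousLinearEquiv : Ambient m →L[ℝ] Ambient m)

theorem repr_fderiv_coe_symm {x : EuclideanSpace ℝ (Fin m)}
    (hx : DifferentiableAt ℝ (fun z => (φ.symm z : Ambient m)) x) (v : EuclideanSpace ℝ (Fin m))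
    (α : Fin (m + 1)) :
    b.repr (fderiv ℝ (fun z => (φ.symm z : Ambient m)) x v) α =
      fderiv ℝ (fun z => coords b (φ.symm z) α) x v := by
  have h : HasFDerivAt (fun z => coords b (φ.symm z) α)
      ((coordsCLM b α).comp (fderiv ℝ (fun z => (φ.symm z : Ambient m)) x)) x :=
    (coordsCLM b α).hasFDerivAt.comp x hx.hasFDerivAt
  rw [h.fderiv]
  rfl

theorem contDiff_coords (α : Fin (m + 1)) : ContDiff ℝ ∞ fun y => coords b y α :=
  (coordsCLM b α).contDiff

theorem inner_eq_coords_dotProduct (u v : Ambient m) :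
    inner ℝ u v = coords b u ⬝ᵥ coords b v := by
  rw [← b.repr.inner_map_map u v, PiLp.inner_apply]
  simp [coords, dotProduct, mul_comm]

theorem coords_dotProduct_self (A : USphere m) : coords b A ⬝ᵥ coords b A = 1 := by
  rw [← inner_eq_coords_dotProduct, real_inner_self_eq_norm_sq, norm_eq_of_mem_sphere, one_pow]

theorem jacobian_mulVec (x : EuclideanSpace ℝ (Fin m)) (v : Fin m → ℝ) :
    jacobian b φ x *ᵥ v =
      coords b (fderiv ℝ (fun z => (φ.symm z : Ambient m)) x (WithLp.toLp 2 v)) := by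
  have hv : WithLp.toLp 2 v = ∑ i, v i • EuclideanSpace.single i (1 : ℝ) := by
    ext j
    simp [Pi.single_apply]
  rw [hv, map_sum]
  ext α
  simp [coords, jacobian, Matrix.mulVec, dotProduct, mul_comm]

variable {φ}

theorem jacobian_det_pos (hφ : φ ∈ IsManifold.maximalAtlas (𝓡 m) ∞ (USphere m))
    {x : EuclideanSpace ℝ (Fin m)} (hx : x ∈ φ.target) :
    0 < ((jacobian b φ x)ᵀ * jacobian b φ x).det := by
  refine det_gram_pos _ fun v w hvw => ?_
  simp only [jacobian_mulVec] at hvw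
  have h1 : ∀ u v : Ambient m, coords b u = coords b v → u = v := fun u v h =>
    b.repr.injective (by ext α; exact congrFun h α)
  exact (WithLp.toLp_injective 2) (fderiv_coe_symm_injective hφ hx (h1 _ _ hvw))

/-- Differentiating `⟨y, y⟩ = 1` along the inverse chart: tangent vectors are orthogonal to the
position vector. -/
theorem coords_vecMul_jacobian (hφ : φ ∈ IsManifold.maximalAtlas (𝓡 m) ∞ (USphere m))
    {x : EuclideanSpace ℝ (Fin m)} (hx : x ∈ φ.target) :
    coords b (φ.symm x) ᵥ* jacobian b φ x = 0 := by
  have hd : DifferentiableAt ℝ (fun z => (φ.symm z : Ambient m)) x :=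
    (contDiffAt_coe_symm hφ hx).differentiableAt (by simp)
  ext i
  have h1 : HasFDerivAt (fun z => inner ℝ (φ.symm z : Ambient m) (φ.symm z : Ambient m)) _ x :=
    hd.hasFDerivAt.inner ℝ hd.hasFDerivAt
  have h2 : (fun z => inner ℝ (φ.symm z : Ambient m) (φ.symm z : Ambient m)) =
      fun _ => (1 : ℝ) := by
    ext z
    rw [real_inner_self_eq_norm_sq, norm_eq_of_mem_sphere, one_pow]
  rw [h2] at h1
  have h3 := congrArg (fun L => L (EuclideanSpace.single i 1))
    (h1.unique (hasFDerivAt_const (1 : ℝ) x))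
  simp only [ContinuousLinearMap.comp_apply, ContinuousLinearMap.prod_apply, fderivInnerCLM_apply,
    _root_.zero_apply] at h3
  rw [real_inner_comm, ← two_mul, real_inner_comm, inner_eq_coords_dotProduct b] at h3
  have h4 : (coords b (φ.symm x) ᵥ* jacobian b φ x) i = coords b (φ.symm x) ⬝ᵥ
      coords b (fderiv ℝ (fun z => (φ.symm z : Ambient m)) x (EuclideanSpace.single i 1)) := rfl
  rw [h4, Pi.zero_apply]
  linarith

/-- This is where the chart drops out: the right-hand side depends only on the point, which makes
all later formulas coordinate-free. -/
theorem jacobian_projection (hφ : φ ∈ IsManifold.maximalAtlas (𝓡 m) ∞ (USphere m))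
    {x : EuclideanSpace ℝ (Fin m)} (hx : x ∈ φ.target) :
    jacobian b φ x * ((jacobian b φ x)ᵀ * jacobian b φ x)⁻¹ * (jacobian b φ x)ᵀ =
      1 - Matrix.vecMulVec (coords b (φ.symm x)) (coords b (φ.symm x)) :=
  mul_gram_inv_mul_transpose_eq _ _ (by simp) (coords_dotProduct_self b _)
    (coords_vecMul_jacobian b hφ hx) (jacobian_det_pos b hφ hx).ne'.isUnit

theorem contDiffAt_jacobian (hφ : φ ∈ IsManifold.maximalAtlas (𝓡 m) ∞ (USphere m))
    {x : EuclideanSpace ℝ (Fin m)} (hx : x ∈ φ.target) (α : Fin (m + 1)) (i : Fin m) :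
    ContDiffAt ℝ ∞ (fun z => jacobian b φ z α i) x := by
  have h := (contDiffAt_coe_symm hφ hx).fderiv_right (m := ∞) (by simp)
  exact (contDiff_coords b α).contDiffAt.comp x (h.clm_apply contDiffAt_const)

/-- Both sides are mixed second partial derivatives of the ambient coordinate `y^α` as a function of
the chart coordinates. -/
theorem fderiv_jacobian_symm (hφ : φ ∈ IsManifold.maximalAtlas (𝓡 m) ∞ (USphere m))
    {x : EuclideanSpace ℝ (Fin m)} (hx : x ∈ φ.target) (i j : Fin m) (α : Fin (m + 1)) :
    fderiv ℝ (fun z => jacobian b φ z α j) x (EuclideanSpace.single i 1) =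
      fderiv ℝ (fun z => jacobian b φ z α i) x (EuclideanSpace.single j 1) := by
  have hcomp : ContDiffAt ℝ ∞ (fun z => coords b (φ.symm z) α) x :=
    (contDiff_coords b α).contDiffAt.comp x (contDiffAt_coe_symm hφ hx)
  have hd : DifferentiableAt ℝ (fderiv ℝ fun z => coords b (φ.symm z) α) x :=
    (hcomp.fderiv_right (m := ∞) (by simp)).differentiableAt (by simp)
  have key : ∀ i j : Fin m,
      fderiv ℝ (fun z => jacobian b φ z α j) x (EuclideanSpace.single i 1) =
        fderiv ℝ (fderiv ℝ fun z => coords b (φ.symm z) α) x (EuclideanSpace.single i 1)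
          (EuclideanSpace.single j 1) := fun i j => by
    have heq : (fun z => jacobian b φ z α j) =ᶠ[nhds x] fun z =>
        fderiv ℝ (fun z => coords b (φ.symm z) α) z (EuclideanSpace.single j 1) := by
      filter_upwards [φ.open_target.mem_nhds hx] with z hz
      exact repr_fderiv_coe_symm b φ ((contDiffAt_coe_symm hφ hz).differentiableAt (by simp)) _ α
    rw [heq.fderiv_eq, (hd.hasFDerivAt.clm_apply (hasFDerivAt_const _ _)).fderiv]
    simp
  rw [key, key]
  have h2 : minSmoothness ℝ 2 ≤ ∞ := by
    rw [minSmoothness_of_isRCLikeNormedField]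
    exact WithTop.coe_le_coe.2 (le_top : (2 : ℕ∞) ≤ ⊤)
  exact (hcomp.isSymmSndFDerivAt h2).eq _ _

/-- This and the next formulas are stated at `φ.symm x` for every `x` in the target, since the
divergence differentiates them in `x`. -/
theorem metricTensor_symm {x : EuclideanSpace ℝ (Fin m)} (hx : x ∈ φ.target) :
    metricTensor φ (φ.symm x) = (jacobian b φ x)ᵀ * jacobian b φ x := by
  ext i j
  simp only [metricTensor, basisVec, Matrix.of_apply, φ.right_inv hx]
  rw [inner_eq_coords_dotProduct b]
  rfl

theorem coords_embedVec_symm {x : EuclideanSpace ℝ (Fin m)} (hx : x ∈ φ.target)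
    (X : USphere m → Fin m → ℝ) :
    coords b (embedVec φ X (φ.symm x)) = jacobian b φ x *ᵥ X (φ.symm x) := by
  ext α
  simp [embedVec, basisVec, φ.right_inv hx, coords, jacobian, Matrix.mulVec, dotProduct, mul_comm]

theorem fderiv_apply_eq_nabla_dotProduct (k : Ambient m → ℝ) (y v : Ambient m) :
    fderiv ℝ k y v = nabla b k y ⬝ᵥ coords b v := by
  conv_lhs => rw [← b.sum_repr v, map_sum]
  simp [nabla, coords, dotProduct, mul_comm]

theorem fderiv_comp_coe_symm (hφ : φ ∈ IsManifold.maximalAtlas (𝓡 m) ∞ (USphere m))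
    {x : EuclideanSpace ℝ (Fin m)} (hx : x ∈ φ.target) {k : Ambient m → ℝ}
    (hk : DifferentiableAt ℝ k (φ.symm x)) (j : Fin m) :
    fderiv ℝ (fun z => k (φ.symm z)) x (EuclideanSpace.single j 1) =
      ((jacobian b φ x)ᵀ *ᵥ nabla b k (φ.symm x)) j := by
  have hd : DifferentiableAt ℝ (fun z => (φ.symm z : Ambient m)) x :=
    (contDiffAt_coe_symm hφ hx).differentiableAt (by simp)
  have h : HasFDerivAt (fun z => k (φ.symm z)) _ x := hk.hasFDerivAt.comp x hd.hasFDerivAt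
  rw [h.fderiv, ContinuousLinearMap.comp_apply, fderiv_apply_eq_nabla_dotProduct b,
    dotProduct_comm]
  rfl

/-! ### Riemannian gradient and Laplacian through an ambient extension -/

variable {h : USphere m → ℝ} {k : Ambient m → ℝ}

/-- Coordinate derivatives see a function only through its values on the sphere, so any extension
differentiable at the point may replace it. -/
theorem partialAt_symm (hφ : φ ∈ IsManifold.maximalAtlas (𝓡 m) ∞ (USphere m))
    {x : EuclideanSpace ℝ (Fin m)} (hx : x ∈ φ.target) (hk : DifferentiableAt ℝ k (φ.symm x))
    (hkh : ∀ A : USphere m, k A = h A) (j : Fin m) :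
    partialAt φ j h (φ.symm x) = ((jacobian b φ x)ᵀ *ᵥ nabla b k (φ.symm x)) j := by
  rw [← fderiv_comp_coe_symm b hφ hx hk, partialAt, φ.right_inv hx]
  simp only [hkh]

theorem gradComp_symm (hφ : φ ∈ IsManifold.maximalAtlas (𝓡 m) ∞ (USphere m))
    {x : EuclideanSpace ℝ (Fin m)} (hx : x ∈ φ.target) (hk : DifferentiableAt ℝ k (φ.symm x))
    (hkh : ∀ A : USphere m, k A = h A) :
    gradComp φ h (φ.symm x) = ((jacobian b φ x)ᵀ * jacobian b φ x)⁻¹ *ᵥ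
      ((jacobian b φ x)ᵀ *ᵥ nabla b k (φ.symm x)) := by
  ext i
  simp only [gradComp, partialAt_symm b hφ hx hk hkh, metricTensor_symm b hx]
  rfl

theorem jacobian_mulVec_gradComp (hφ : φ ∈ IsManifold.maximalAtlas (𝓡 m) ∞ (USphere m))
    {x : EuclideanSpace ℝ (Fin m)} (hx : x ∈ φ.target) (hk : DifferentiableAt ℝ k (φ.symm x))
    (hkh : ∀ A : USphere m, k A = h A) :
    jacobian b φ x *ᵥ gradComp φ h (φ.symm x) = projNabla b k (φ.symm x) := by
  rw [gradComp_symm b hφ hx hk hkh, Matrix.mulVec_mulVec, Matrix.mulVec_mulVec,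
    jacobian_projection b hφ hx, projNabla]

/-- The Riemannian gradient on the sphere is the projection of the ambient gradient. -/
theorem coords_gradVec {A : USphere m} (hφ : IsCoordAt φ A) (hk : DifferentiableAt ℝ k A)
    (hkh : ∀ A : USphere m, k A = h A) : coords b (gradVec φ h A) = projNabla b k A := by
  have hx := φ.map_source hφ.2
  have hA := φ.left_inv hφ.2
  rw [← hA] at hk ⊢
  rw [gradVec, coords_embedVec_symm b hx, jacobian_mulVec_gradComp b hφ.1 hx hk hkh]

theorem projNabla_apply (k : Ambient m → ℝ) (y : Ambient m) (α : Fin (m + 1)) :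
    projNabla b k y α = nabla b k y α - coords b y α * (coords b y ⬝ᵥ nabla b k y) := by
  rw [projNabla, Matrix.sub_mulVec, Matrix.one_mulVec, Matrix.vecMulVec_mulVec]
  simp [mul_comm]

/-- The transposed Jacobian in the partial derivatives of `l` is moved onto the components of the
gradient, where it becomes the projection. -/
theorem act_gradComp {A : USphere m} (hφ : IsCoordAt φ A) (hk : DifferentiableAt ℝ k A)
    (hkh : ∀ A : USphere m, k A = h A) {l : USphere m → ℝ} {L : Ambient m → ℝ}
    (hL : DifferentiableAt ℝ L A) (hLl : ∀ A : USphere m, L A = l A) :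
    act φ (gradComp φ h) l A = nabla b L A ⬝ᵥ projNabla b k A := by
  have hx := φ.map_source hφ.2
  have hA := φ.left_inv hφ.2
  rw [← hA] at hk hL ⊢
  rw [← jacobian_mulVec_gradComp b hφ.1 hx hk hkh, Matrix.dotProduct_mulVec,
    ← Matrix.mulVec_transpose, dotProduct_comm]
  simp only [act, partialAt_symm b hφ.1 hx hL hLl]
  rfl

theorem contDiffAt_nabla {k : Ambient m → ℝ} {y : Ambient m} (hk : ContDiffAt ℝ ∞ k y)
    (α : Fin (m + 1)) : ContDiffAt ℝ ∞ (fun z => nabla b k z α) y :=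
  (hk.fderiv_right (m := ∞) (by simp)).clm_apply contDiffAt_const

theorem nabla_coords (y : Ambient m) (α β : Fin (m + 1)) :
    nabla b (fun z => coords b z α) y β = if β = α then 1 else 0 := by
  have h : HasFDerivAt (fun z => coords b z α) (coordsCLM b α) y := (coordsCLM b α).hasFDerivAt
  rw [nabla, h.fderiv]
  simp [coordsCLM, eq_comm]

theorem differentiableAt_coords_dotProduct_nabla {y : Ambient m} (hk : ContDiffAt ℝ ∞ k y) :
    DifferentiableAt ℝ (fun z => coords b z ⬝ᵥ nabla b k z) y :=
  DifferentiableAt.fun_sum fun α _ => ((contDiff_coords b α).contDiffAt.differentiableAt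
    (by simp)).mul ((contDiffAt_nabla b hk α).differentiableAt (by simp))

theorem differentiableAt_projNabla {y : Ambient m} (hk : ContDiffAt ℝ ∞ k y)
    (α : Fin (m + 1)) : DifferentiableAt ℝ (fun z => projNabla b k z α) y := by
  simp only [projNabla_apply]
  exact ((contDiffAt_nabla b hk α).differentiableAt (by simp)).sub
    (((contDiff_coords b α).contDiffAt.differentiableAt (by simp)).mul
      (differentiableAt_coords_dotProduct_nabla b hk))

/-- The derivative of `yᵀ∇k` is left unexpanded because its contribution cancels in the Laplacian.
-/
theorem nabla_projNabla {y : Ambient m} (hk : ContDiffAt ℝ ∞ k y) (α β : Fin (m + 1)) :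
    nabla b (fun z => projNabla b k z α) y β = hessian b k y β α -
      ((if β = α then 1 else 0) * (coords b y ⬝ᵥ nabla b k y) +
        coords b y α * nabla b (fun z => coords b z ⬝ᵥ nabla b k z) y β) := by
  have h1 := ((contDiffAt_nabla b hk α).differentiableAt (by simp)).hasFDerivAt
  have h2 := ((contDiff_coords b α).contDiffAt (x := y).differentiableAt (by simp)).hasFDerivAt
  have h3 := (differentiableAt_coords_dotProduct_nabla b hk).hasFDerivAt
  have h4 : HasFDerivAt (fun z => nabla b k z α - coords b z α * (coords b z ⬝ᵥ nabla b k z)) _ y :=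
    h1.sub (h2.mul h3)
  rw [← nabla_coords b y α β]
  simp only [projNabla_apply]
  rw [nabla, h4.fderiv]
  simp only [hessian, nabla, Matrix.of_apply, _root_.sub_apply, _root_.add_apply,
    _root_.smul_apply, smul_eq_mul]
  ring

/-- The Laplace-Beltrami operator of the sphere in terms of ambient derivatives. -/
theorem laplaceBeltrami_eq {A : USphere m} (hφ : IsCoordAt φ A)
    (hk : ∀ A : USphere m, ContDiffAt ℝ ∞ k A) (hkh : ∀ A : USphere m, k A = h A) :
    laplaceBeltrami φ h A = ∑ α, nabla b (fun z => nabla b k z α) A α -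
      coords b A ⬝ᵥ (hessian b k A *ᵥ coords b A) - m * (coords b A ⬝ᵥ nabla b k A) := by
  have hx := φ.map_source hφ.2
  have hA := φ.left_inv hφ.2
  set x := φ A with hxdef
  have hkd : ∀ B : USphere m, DifferentiableAt ℝ k B := fun B =>
    (hk B).differentiableAt (by simp)
  have hJ : ∀ α i, DifferentiableAt ℝ (fun z => jacobian b φ z α i) x := fun α i =>
    (contDiffAt_jacobian b hφ.1 hx α i).differentiableAt (by simp)
  have htgt := φ.open_target.mem_nhds hx
  have hdet := jacobian_det_pos b hφ.1 hx
  have hG : ∀ i j, DifferentiableAt ℝ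
      (fun z => ((jacobian b φ z)ᵀ * jacobian b φ z) i j) x := fun i j => by
    simp only [Matrix.mul_apply, Matrix.transpose_apply]
    exact DifferentiableAt.fun_sum fun α _ => (hJ α i).mul (hJ α j)
  have hnab : ∀ α, DifferentiableAt ℝ (fun z => nabla b k (φ.symm z) α) x := fun α =>
    DifferentiableAt.comp (g := fun y => nabla b k y α) x
      ((contDiffAt_nabla b (hk (φ.symm x)) α).differentiableAt (by simp))
      ((contDiffAt_coe_symm hφ.1 hx).differentiableAt (by simp))
  have hW : ∀ i, DifferentiableAt ℝ (fun z => gradComp φ h (φ.symm z) i) x := fun i => by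
    have heq : (fun z => gradComp φ h (φ.symm z) i) =ᶠ[nhds x] fun z =>
        (((jacobian b φ z)ᵀ * jacobian b φ z)⁻¹ *ᵥ
          ((jacobian b φ z)ᵀ *ᵥ nabla b k (φ.symm z))) i := by
      filter_upwards [htgt] with z hz
      rw [gradComp_symm b hφ.1 hz (hkd _) hkh]
    refine DifferentiableAt.congr_of_eventuallyEq ?_ heq
    simp only [Matrix.mulVec, dotProduct, Matrix.transpose_apply]
    exact DifferentiableAt.fun_sum fun j _ => (differentiableAt_inv_apply hG hdet.ne' i j).mul
      (DifferentiableAt.fun_sum fun α _ => (hJ α j).mul (hnab α))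
  have hdiv : laplaceBeltrami φ h A =
      (∑ i, fderiv ℝ (fun z => Real.sqrt ((jacobian b φ z)ᵀ * jacobian b φ z).det *
        gradComp φ h (φ.symm z) i) x (EuclideanSpace.single i 1)) /
        Real.sqrt ((jacobian b φ x)ᵀ * jacobian b φ x).det := by
    rw [laplaceBeltrami, divergence]
    congr 1
    · refine Finset.sum_congr rfl fun i _ => ?_
      rw [partialAt, ← hxdef]
      congr 1
      refine Filter.EventuallyEq.fderiv_eq ?_
      filter_upwards [htgt] with z hz
      rw [sqrtDet, metricTensor_symm b hz]
    · rw [← metricTensor_symm b hx, hA, sqrtDet]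
  -- Near `x` the pushed-forward gradient is the restriction of the ambient field `projNabla b k`,
  -- so the chain rule differentiates it.
  have hV : ∀ α j, fderiv ℝ (fun z => (jacobian b φ z *ᵥ gradComp φ h (φ.symm z)) α) x
      (EuclideanSpace.single j 1) =
      ∑ β, jacobian b φ x β j * nabla b (fun z => projNabla b k z α) A β := fun α j => by
    have heq : (fun z => (jacobian b φ z *ᵥ gradComp φ h (φ.symm z)) α) =ᶠ[nhds x]
        fun z => projNabla b k (φ.symm z) α := by
      filter_upwards [htgt] with z hz
      rw [jacobian_mulVec_gradComp b hφ.1 hz (hkd _) hkh]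
    rw [heq.fderiv_eq, fderiv_comp_coe_symm b hφ.1 hx (differentiableAt_projNabla b (hk _) α), hA]
    rfl
  rw [hdiv, sum_fderiv_sqrt_det_mul_div _ hJ
    (fun i j α => fderiv_jacobian_symm b hφ.1 hx i j α) hW hdet]
  simp only [hV]
  set T : Matrix (Fin (m + 1)) (Fin (m + 1)) ℝ :=
    Matrix.of fun β α => nabla b (fun z => projNabla b k z α) A β with hT
  have htr : ∑ j, ∑ α, (jacobian b φ x * ((jacobian b φ x)ᵀ * jacobian b φ x)⁻¹) α j *
      ∑ β, jacobian b φ x β j * nabla b (fun z => projNabla b k z α) A β =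
      ((1 - Matrix.vecMulVec (coords b A) (coords b A)) * T).trace := by
    have hproj := jacobian_projection b hφ.1 hx
    rw [hA] at hproj
    rw [← hproj, Matrix.mul_assoc, Matrix.trace, Finset.sum_comm]
    refine Finset.sum_congr rfl fun α _ => ?_
    rw [Matrix.diag_apply, Matrix.mul_apply]
    refine Finset.sum_congr rfl fun j _ => ?_
    congr 1
  rw [htr, trace_one_sub_vecMulVec_mul]
  set s := coords b A ⬝ᵥ nabla b k A with hs
  set u : Fin (m + 1) → ℝ := nabla b (fun z => coords b z ⬝ᵥ nabla b k z) A with hu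
  -- Against `P = 1 - y yᵀ`, the multiple of the identity contributes `s * tr P = m * s`, and `u yᵀ`
  -- contributes `yᵀ P u = 0`.
  have hTeq : T = hessian b k A - (s • (1 : Matrix _ _ ℝ) + Matrix.vecMulVec u (coords b A)) := by
    ext β α
    simp only [hT, Matrix.of_apply, nabla_projNabla b (hk A), Matrix.sub_apply, Matrix.add_apply,
      Matrix.smul_apply, Matrix.one_apply, Matrix.vecMulVec_apply, smul_eq_mul]
    ring
  have hHtr : (hessian b k A).trace = ∑ α, nabla b (fun z => nabla b k z α) A α := rfl
  rw [hTeq, Matrix.trace_sub, Matrix.trace_add, Matrix.trace_smul, Matrix.trace_one,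
    Matrix.trace_vecMulVec, Matrix.sub_mulVec, Matrix.add_mulVec, Matrix.smul_mulVec,
    Matrix.one_mulVec, Matrix.vecMulVec_mulVec, coords_dotProduct_self, hHtr]
  simp only [dotProduct_sub, dotProduct_add, dotProduct_smul, coords_dotProduct_self,
    Fintype.card_fin, smul_eq_mul, MulOpposite.op_one, one_smul]
  rw [dotProduct_comm u]
  push_cast
  ring

/-- The Stein term on the sphere agrees with the embedded expression. -/
theorem steinTerm_eq_embeddedTerm {p : USphere m → ℝ} (hpos : ∀ A, 0 < p A)
    {K : USphere m → USphere m → ℝ} {pE : Ambient m → ℝ} (hpE : ∀ A : USphere m, pE A = p A)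
    (hpE_smooth : ∀ A : USphere m, ContDiffAt ℝ ∞ pE (A : Ambient m)) {A A' : USphere m}
    (hk : ∀ A : USphere m, ContDiffAt ℝ ∞ k A) (hkK : ∀ A : USphere m, k A = K A A')
    (hφ : IsCoordAt φ A) :
    steinTerm φ p K A' A = embeddedTerm b pE k A := by
  have hL : DifferentiableAt ℝ (fun z => Real.log (pE z)) A :=
    ((hpE_smooth A).differentiableAt (by simp)).log (by rw [hpE]; exact (hpos A).ne')
  rw [steinTerm, embeddedTerm, laplaceBeltrami_eq b hφ hk hkK,
    act_gradComp b hφ ((hk A).differentiableAt (by simp)) hkK hL (fun B => by rw [hpE])]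
  have h1 : projNabla b k A =
      nabla b k A - (coords b A ⬝ᵥ nabla b k A) • coords b A := by
    ext α
    rw [projNabla_apply]
    simp [mul_comm]
  rw [h1, dotProduct_sub, dotProduct_smul, smul_eq_mul, dotProduct_comm _ (coords b A)]
  push_cast
  ring

end Charts

/-! ### Differentiation under the integral sign -/

section Parametric

/-- Differentiation under an integral over a compact set, for an integrand which is continuously
differentiable at the points concerned. -/
theorem differentiableAt_integral_of_contDiffAt {E F : Type*} [NormedAddCommGroup E]
    [NormedSpace ℝ E] [NormedAddCommGroup F] [NormedSpace ℝ F] [SecondCountableTopology F]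
    [FiniteDimensional ℝ F] {X : Type*} [TopologicalSpace X] [CompactSpace X]
    [MeasurableSpace X] [BorelSpace X] (μ : Measure X) [IsFiniteMeasure μ] {i : X → E}
    (hi : Continuous i) {g : E → F → ℝ} {y : F}
    (hg : ∀ a : X, ContDiffAt ℝ 1 (Function.uncurry g) (i a, y)) :
    DifferentiableAt ℝ (fun z => ∫ a, g (i a) z ∂μ) y := by
  -- Compactness of `X` turns the local derivative bounds into one neighbourhood of `y` and one
  -- constant; the constant dominates because the measure is finite.
  have hC : ∃ V ∈ nhds y, ∃ C : ℝ, ∀ a : X, ∀ z ∈ V,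
      ContDiffAt ℝ 1 (Function.uncurry g) (i a, z) ∧
        ‖fderiv ℝ (Function.uncurry g) (i a, z)‖ ≤ C := by
    have hloc : ∀ a : X, ∃ U ∈ nhds a, ∃ V ∈ nhds y, ∃ C : ℝ, ∀ a' ∈ U, ∀ z ∈ V,
        ContDiffAt ℝ 1 (Function.uncurry g) (i a', z) ∧
          ‖fderiv ℝ (Function.uncurry g) (i a', z)‖ ≤ C := fun a => by
      have h1 : ∀ᶠ w in nhds (i a, y), ContDiffAt ℝ 1 (Function.uncurry g) w :=
        (hg a).eventually (by simp)
      have h2 : ContinuousAt (fun w => ‖fderiv ℝ (Function.uncurry g) w‖) (i a, y) :=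
        ((hg a).fderiv_right (m := 0) (by simp)).continuousAt.norm
      have h3 : ∀ᶠ w in nhds (i a, y), ‖fderiv ℝ (Function.uncurry g) w‖ <
          ‖fderiv ℝ (Function.uncurry g) (i a, y)‖ + 1 :=
        h2.eventually (gt_mem_nhds (lt_add_one _))
      have h4 : Filter.Tendsto (fun w : X × F => (i w.1, w.2)) (nhds (a, y)) (nhds (i a, y)) :=
        ((hi.comp continuous_fst).prodMk continuous_snd).tendsto (a, y)
      obtain ⟨U, hU, V, hV, hUV⟩ := mem_nhds_prod_iff.1 (h4.eventually (h1.and h3))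
      exact ⟨U, hU, V, hV, _, fun a' ha' z hz =>
        ⟨(hUV (Set.mk_mem_prod ha' hz)).1, (hUV (Set.mk_mem_prod ha' hz)).2.le⟩⟩
    choose U hU V hV C hUVC using hloc
    obtain ⟨t, -, ht⟩ := isCompact_univ.elim_nhds_subcover U fun a _ => hU a
    refine ⟨⋂ a ∈ t, V a, (Filter.biInter_finset_mem t).2 fun a _ => hV a, ∑ a ∈ t, |C a|,
      fun a' z hz => ?_⟩
    obtain ⟨a, hat, ha⟩ := Set.mem_iUnion₂.1 (ht (Set.mem_univ a'))
    have := hUVC a a' ha z (Set.mem_iInter₂.1 hz a hat)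
    exact ⟨this.1, this.2.trans ((le_abs_self _).trans
      (Finset.single_le_sum (f := fun a => |C a|) (fun _ _ => abs_nonneg _) hat))⟩
  obtain ⟨V, hV, C, hVC⟩ := hC
  have hcont : ∀ z ∈ V, Continuous fun a => g (i a) z := fun z hz =>
    continuous_iff_continuousAt.2 fun a =>
      ContinuousAt.comp (g := Function.uncurry g) (f := fun a => (i a, z))
        (hVC a z hz).1.continuousAt (hi.prodMk continuous_const).continuousAt
  have hcont' : Continuous fun a => (fderiv ℝ (Function.uncurry g) (i a, y)).comp
      (ContinuousLinearMap.inr ℝ E F) := by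
    refine Continuous.clm_comp (continuous_iff_continuousAt.2 fun a => ?_) continuous_const
    exact ContinuousAt.comp (g := fderiv ℝ (Function.uncurry g)) (f := fun a => (i a, y))
      ((hg a).fderiv_right (m := 0) (by simp)).continuousAt
      (hi.prodMk continuous_const).continuousAt
  have hyV := mem_of_mem_nhds hV
  refine (hasFDerivAt_integral_of_dominated_of_fderiv_le (s := V)
    (F' := fun z a => (fderiv ℝ (Function.uncurry g) (i a, z)).comp
      (ContinuousLinearMap.inr ℝ E F)) (bound := fun _ => C * ‖ContinuousLinearMap.inr ℝ E F‖)
    hV ?_ ?_ ?_ ?_ (integrable_const _) ?_).differentiableAt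
  · filter_upwards [hV] with z hz using (hcont z hz).aestronglyMeasurable
  · exact (hcont y hyV).integrable_of_hasCompactSupport (HasCompactSupport.of_compactSpace _)
  · exact hcont'.aestronglyMeasurable
  · exact Filter.Eventually.of_forall fun a z hz =>
      (ContinuousLinearMap.opNorm_comp_le _ _).trans
        (mul_le_mul_of_nonneg_right (hVC a z hz).2 (norm_nonneg _))
  · refine Filter.Eventually.of_forall fun a z hz => ?_
    exact ((hVC a z hz).1.differentiableAt (by simp)).hasFDerivAt.comp z
      (hasFDerivAt_prodMk_right (i a) z)

end Parametric

/-! ### Joint smoothness of the embedded integrand -/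

section Embedded

variable {m : ℕ} (b : OrthonormalBasis (Fin (m + 1)) ℝ (Ambient m))

/-- A partial derivative in the first argument is the total derivative applied to `(b α, 0)`. At
order `∞` no smoothness is lost, so the lemma can be iterated for the Hessian. -/
theorem contDiffAt_uncurry_nabla {K : Ambient m → Ambient m → ℝ} {y y' : Ambient m}
    (hK : ContDiffAt ℝ ∞ (Function.uncurry K) (y, y')) (α : Fin (m + 1)) :
    ContDiffAt ℝ ∞ (Function.uncurry fun z z' => nabla b (fun w => K w z') z α) (y, y') := by
  have h : ContDiffAt ℝ ∞ (fun w => fderiv ℝ (Function.uncurry K) w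
      (ContinuousLinearMap.inl ℝ (Ambient m) (Ambient m) (b α))) (y, y') :=
    (hK.fderiv_right (m := ∞) (by simp)).clm_apply contDiffAt_const
  refine h.congr_of_eventuallyEq ?_
  -- Smoothness of order `∞` at a point need not persist on a neighbourhood, but each finite order
  -- does; order 1 suffices here.
  have h1 : ContDiffAt ℝ 1 (Function.uncurry K) (y, y') := hK.of_le (by simp)
  filter_upwards [h1.eventually (by simp)] with w hw
  have h2 : HasFDerivAt (fun z => K z w.2) ((fderiv ℝ (Function.uncurry K) w).comp
      (ContinuousLinearMap.inl ℝ (Ambient m) (Ambient m))) w.1 :=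
    HasFDerivAt.comp (g := Function.uncurry K) (f := fun z => (z, w.2)) w.1
      (hw.differentiableAt (by simp)).hasFDerivAt (hasFDerivAt_prodMk_left w.1 w.2)
  simp only [Function.uncurry, nabla, h2.fderiv]
  rfl

/-- Joint smoothness of the embedded expression. -/
theorem contDiffAt_uncurry_embeddedTerm {p : Ambient m → ℝ} {K : Ambient m → Ambient m → ℝ}
    {y y' : Ambient m} (hp : ContDiffAt ℝ ∞ p y) (hpy : p y ≠ 0)
    (hK : ContDiffAt ℝ ∞ (Function.uncurry K) (y, y')) :
    ContDiffAt ℝ ∞ (Function.uncurry fun z z' => embeddedTerm b p (fun w => K w z') z)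
      (y, y') := by
  have hlog : ∀ α, ContDiffAt ℝ ∞
      (fun w : Ambient m × Ambient m => nabla b (fun z => Real.log (p z)) w.1 α) (y, y') :=
    fun α => (contDiffAt_nabla b (hp.log hpy) α).comp (y, y') contDiffAt_fst
  have hco : ∀ α, ContDiffAt ℝ ∞ (fun w : Ambient m × Ambient m => coords b w.1 α) (y, y') :=
    fun α => (contDiff_coords b α).contDiffAt.comp (y, y') contDiffAt_fst
  have hn : ∀ α, ContDiffAt ℝ ∞
      (fun w : Ambient m × Ambient m => nabla b (fun z => K z w.2) w.1 α) (y, y') :=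
    fun α => contDiffAt_uncurry_nabla b hK α
  have hH : ∀ α β, ContDiffAt ℝ ∞ (fun w : Ambient m × Ambient m =>
      nabla b (fun u => nabla b (fun z => K z w.2) u β) w.1 α) (y, y') :=
    fun α β => contDiffAt_uncurry_nabla b
      (K := fun z z' => nabla b (fun w => K w z') z β) (contDiffAt_uncurry_nabla b hK β) α
  simp only [embeddedTerm, hessian, dotProduct, Matrix.mulVec, Matrix.of_apply,
    Function.uncurry_def]
  refine ContDiffAt.sub (ContDiffAt.sub (ContDiffAt.add ?_ ?_) ?_) (ContDiffAt.mul ?_ ?_)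
  · exact ContDiffAt.sum fun α _ => (hlog α).mul (hn α)
  · exact ContDiffAt.sum fun α _ => hH α α
  · exact ContDiffAt.sum fun α _ => (hco α).mul
      (ContDiffAt.sum fun β _ => (hH α β).mul (hco β))
  · exact ((ContDiffAt.sum fun α _ => (hco α).mul (hlog α)).add contDiffAt_const).sub
      contDiffAt_const
  · exact ContDiffAt.sum fun α _ => (hco α).mul (hn α)

end Embedded

end SphereRSVGD

/-! ### The main theorem -/

open SphereRSVGD in
theorem proposition7 (m : ℕ)
    (b : OrthonormalBasis (Fin (m + 1)) ℝ (Ambient m))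
    -- the density, the kernel and the distribution on the sphere
    (p : USphere m → ℝ) (hp : ContMDiff (𝓡 m) 𝓘(ℝ, ℝ) ∞ p) (hpos : ∀ A, 0 < p A)
    (K : USphere m → USphere m → ℝ)
    (hK : ContMDiff ((𝓡 m).prod (𝓡 m)) 𝓘(ℝ, ℝ) ∞ (Function.uncurry K))
    (q : Measure (USphere m)) [IsProbabilityMeasure q]
    -- arbitrary smooth expressions of the density and the kernel in the ambient space
    (pE : Ambient m → ℝ) (hpE : ∀ A : USphere m, pE A = p A)
    (hpE_smooth : ∀ A : USphere m, ContDiffAt ℝ ∞ pE (A : Ambient m))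
    (KE : Ambient m → Ambient m → ℝ) (hKE : ∀ A A' : USphere m, KE A A' = K A A')
    (hKE_smooth : ∀ A A' : USphere m,
      ContDiffAt ℝ ∞ (Function.uncurry KE) ((A : Ambient m), (A' : Ambient m)))
    -- an arbitrary choice of a coordinate system around each point
    (c : USphere m → LocalMap m) (hc : ∀ A, IsCoordAt (c A) A) :
    -- the two expressions of the function agree, and both expectations exist
    (∀ A' : USphere m,
      Integrable (fun A => steinTerm (c A) p K A' A) q ∧
      Integrable (fun A : USphere m => embeddedTerm b pE (fun y => KE y A') A) q ∧
      fHat c p K q A' = embeddedFHat b pE KE q A') ∧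
    -- its gradient, in any coordinate system, is the projected Euclidean gradient
    (∀ A' : USphere m, DifferentiableAt ℝ (embeddedFHat b pE KE q) (A' : Ambient m) ∧
      ∀ φ : LocalMap m, IsCoordAt φ A' →
        coords b (gradVec φ (fHat c p K q) A') = projNabla b (embeddedFHat b pE KE q) A') ∧
    -- and this holds for every expression of the function in the ambient space
    (∀ F : Ambient m → ℝ, (∀ A' : USphere m, F A' = fHat c p K q A') →
      ∀ A' : USphere m, DifferentiableAt ℝ F (A' : Ambient m) →
        ∀ φ : LocalMap m, IsCoordAt φ A' →
          coords b (gradVec φ (fHat c p K q) A') = projNabla b F A') := by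
  have hpE0 : ∀ A : USphere m, pE A ≠ 0 := fun A => by rw [hpE]; exact (hpos A).ne'
  have hk : ∀ A A' : USphere m, ContDiffAt ℝ ∞ (fun y => KE y A') (A : Ambient m) := fun A A' =>
    (hKE_smooth A A').comp (A : Ambient m) (contDiffAt_id.prodMk contDiffAt_const)
  -- The identity is pointwise in `A`, so the choice `c` needs no measurability: the integrand
  -- equals one that is continuous on the sphere.
  have hst : ∀ A' A : USphere m,
      steinTerm (c A) p K A' A = embeddedTerm b pE (fun y => KE y A') A := fun A' A =>
    steinTerm_eq_embeddedTerm b hpos hpE hpE_smooth (fun B => hk B A') (fun B => hKE B A') (hc A)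
  have hterm : ∀ A A' : USphere m, ContDiffAt ℝ ∞
      (Function.uncurry fun z z' => embeddedTerm b pE (fun w => KE w z') z)
        ((A : Ambient m), (A' : Ambient m)) := fun A A' =>
    contDiffAt_uncurry_embeddedTerm b (hpE_smooth A) (hpE0 A) (hKE_smooth A A')
  have hint : ∀ A' : USphere m,
      Integrable (fun A : USphere m => embeddedTerm b pE (fun y => KE y A') A) q := fun A' => by
    have hcont : Continuous fun A : USphere m => embeddedTerm b pE (fun y => KE y A') A :=
      continuous_iff_continuousAt.2 fun A =>
        ContinuousAt.comp (f := fun A : USphere m => ((A : Ambient m), (A' : Ambient m)))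
          (hterm A A').continuousAt (by fun_prop)
    exact hcont.integrable_of_hasCompactSupport (HasCompactSupport.of_compactSpace _)
  have heq : ∀ A' : USphere m, fHat c p K q A' = embeddedFHat b pE KE q A' := fun A' => by
    simp only [fHat, embeddedFHat, hst]
  have hgrad : ∀ F : Ambient m → ℝ, (∀ A' : USphere m, F A' = fHat c p K q A') →
      ∀ A' : USphere m, DifferentiableAt ℝ F (A' : Ambient m) →
        ∀ φ : LocalMap m, IsCoordAt φ A' →
          coords b (gradVec φ (fHat c p K q) A') = projNabla b F A' :=
    fun F hF A' hFd φ hφ => coords_gradVec b hφ hFd hF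
  refine ⟨fun A' => ⟨?_, hint A', heq A'⟩, fun A' => ?_, hgrad⟩
  · simp only [hst]
    exact hint A'
  · have hd : DifferentiableAt ℝ (embeddedFHat b pE KE q) (A' : Ambient m) :=
      differentiableAt_integral_of_contDiffAt q
        (g := fun z z' => embeddedTerm b pE (fun w => KE w z') z) continuous_subtype_val
        fun A => (hterm A A').of_le (by simp)
    exact ⟨hd, hgrad _ (fun B => (heq B).symm) A' hd⟩
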